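/- Let $n\ge 2$ and let $u$ be a (complex-valued) harmonic function on $\mathbb{R}^n$. For $x\in\mathbb{R}^n$ and $r>0$ let $B_{x,r}$ be the open ball with centre $x$ and radius $r$, let $\nu$ be Lebesgue measure, and put $$A_2(x,r,u)=\Big(\frac1{\nu(B_{x,r})}\int_{B_{x,r}}|u|^2\,d\nu\Big)^{1/2},\qquad A_2(r,u)=A_2(0,r,u).$$ Suppose that $A_2(r,u)\le\varphi(r)$ for all $r>0$, where $\varphi:[0,\infty)\to\mathbb{R}$ is increasing (not necessarily strictly). Let $x_m\in\mathbb{R}^n$, $r_m>0$ and $\varepsilon_m>0$ $(m\in\mathbb{N})$ be sequences such that $0<2r_m\le|x_m|$ and $A_2(x_m,r_m,u)\le\varepsilon_m$ for every $m$, and such that $(x_m)$ does not converge to $0$. If $$\lim_{m\to\infty}\Big[\frac{\rho_m}{100}\log\varepsilon_m+\varphi(4|x_m|)\Big]=-\infty,\qquad\text{where }\rho_m=\frac{1}{\log\frac{2|x_m|}{r_m}},$$ then $u\equiv 0$ in $\mathbb{R}^n$. -/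

import Mathlib

open MeasureTheory

/-- The averaged `L^p` norm of `f` over the open ball `B_{x,r}` of `ℝⁿ`:
`A_p(x, r, f) = (ν(B_{x,r})⁻¹ ∫_{B_{x,r}} |f|^p dν)^{1/p}`, with `ν` Lebesgue measure. -/
noncomputable def ballMean {n : ℕ} (p : ℝ) (x : EuclideanSpace ℝ (Fin n)) (r : ℝ)
    (f : EuclideanSpace ℝ (Fin n) → ℂ) : ℝ :=
  ((volume.real (Metric.ball x r))⁻¹ * ∫ y in Metric.ball x r, ‖f y‖ ^ p) ^ (1 / p)

/-- The averaged norm over a ball centred at the origin: `A_p(r, f) = A_p(0, r, f)`. -/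
noncomputable def ballMeanZero {n : ℕ} (p : ℝ) (r : ℝ)
    (f : EuclideanSpace ℝ (Fin n) → ℂ) : ℝ :=
  ballMean p 0 r f

/-! The proof propagates smallness with an L² three balls inequality. With the weight w(y) = (1 -
‖y‖²)₊, put E(x, ρ) = ∫ w(y) ‖u(x + ρy)‖² dy. Since w(y)y = -∇(w²/4), integration by parts gives
Green's identity without boundary terms. Applied to the dilates u(eᵗy) and u(e⁻ᵗy), it shows that
their w-weighted pairing is constant in t (`integral_inner_exp_smul`). Cauchy–Schwarz then yields
E(ρ)² ≤ E(ρ/q) E(qρ), and iteration gives E(ρqᵏ)ᵏ⁺¹ ≤ E(ρ) E(ρqᵏ⁺¹)ᵏ (`ballEnergy_pow_le`).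

About x_m, go from radius r_m to a radius comparable to |x_m|: the inner energy is controlled by
ε_m, the outer one by φ(4|x_m|), and k + 1 is at most a multiple of log(2|x_m|/r_m). This bounds
E(0, |x_m|/2) by C exp(2[⋯]), with [⋯] the bracket that tends to -∞ (`ballEnergy_zero_le`). As |x_m|
≥ δ infinitely often, monotonicity in the radius forces E(0, δ/2) = 0, and the three balls
inequality spreads this zero to the whole space. -/

/-! ### The radial weight and its potential. -/

section BallWeight

variable {E : Type*} [NormedAddCommGroup E]

/-- The radial weight `(1 - ‖y‖²)₊`, supported in the closed unit ball. -/
noncomputable def ballWeight (y : E) : ℝ := max 0 (1 - ‖y‖ ^ 2)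

lemma ballWeight_nonneg (y : E) : 0 ≤ ballWeight y := le_max_left _ _

lemma ballWeight_eq_zero {y : E} (hy : 1 ≤ ‖y‖) : ballWeight y = 0 :=
  max_eq_left (by nlinarith)

lemma ballWeight_le_one (y : E) : ballWeight y ≤ 1 :=
  max_le zero_le_one (by nlinarith [norm_nonneg y])

lemma continuous_ballWeight : Continuous (ballWeight : E → ℝ) := by
  unfold ballWeight
  fun_prop

lemma hasDerivAt_posPart_sq (s : ℝ) :
    HasDerivAt (fun s : ℝ => (max 0 s) ^ 2 / 4) (max 0 s / 2) s := by
  rcases lt_trichotomy s 0 with h | h | h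
  · rw [max_eq_left h.le]
    refine ((hasDerivAt_const s (0 : ℝ)).congr_of_eventuallyEq ?_).congr_deriv (by simp)
    filter_upwards [eventually_lt_nhds h] with t ht
    simp [max_eq_left ht.le]
  -- At the kink the function is O(t²), so its derivative vanishes.
  · subst h
    rw [max_self, zero_div, hasDerivAt_iff_isLittleO]
    have h1 : (fun t : ℝ => t ^ 2) =o[nhds 0] fun t : ℝ => t := by
      simpa using Asymptotics.isLittleO_pow_id (𝕜 := ℝ) one_lt_two
    refine Asymptotics.IsBigO.trans_isLittleO ?_ (by simpa using h1)
    refine Asymptotics.IsBigO.of_bound 1 (Filter.Eventually.of_forall fun t => ?_)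
    have ht : |max 0 t| ≤ |t| := by
      rcases le_total t 0 with ht | ht
      · simp [max_eq_left ht]
      · rw [max_eq_right ht]
    have hsq : (max 0 t) ^ 2 ≤ t ^ 2 := sq_le_sq.2 ht
    have hn : 0 ≤ (max 0 t) ^ 2 / 4 := by positivity
    simp only [max_self, sub_zero, smul_zero, Real.norm_eq_abs, one_mul, ne_eq,
      OfNat.ofNat_ne_zero, not_false_eq_true, zero_pow, zero_div, abs_of_nonneg hn, abs_sq]
    linarith [sq_nonneg (max 0 t)]
  · rw [max_eq_right h.le]
    refine (((hasDerivAt_id s).pow 2).div_const 4).congr_of_eventuallyEq ?_ |>.congr_deriv ?_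
    · filter_upwards [eventually_gt_nhds h] with t ht
      simp [max_eq_right ht.le]
    · simp; ring

lemma hasCompactSupport_ballWeight [ProperSpace E] :
    HasCompactSupport (ballWeight : E → ℝ) := by
  refine HasCompactSupport.intro (isCompact_closedBall (0 : E) 1) fun y hy => ?_
  exact ballWeight_eq_zero (by simpa using (not_le.1 (by simpa using hy)).le)

variable [InnerProductSpace ℝ E]

lemma hasFDerivAt_ballWeight_sq (y : E) :
    HasFDerivAt (fun y : E => ballWeight y ^ 2 / 4) (-(ballWeight y) • innerSL ℝ y) y := by
  have h1 : HasFDerivAt (fun y : E => 1 - ‖y‖ ^ 2) (-(2 • innerSL ℝ y)) y :=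
    (hasStrictFDerivAt_norm_sq y).hasFDerivAt.const_sub 1
  refine ((hasDerivAt_posPart_sq _).comp_hasFDerivAt y h1).congr_fderiv ?_
  ext v
  simp [ballWeight]
  ring

variable [FiniteDimensional ℝ E] [MeasurableSpace E] [BorelSpace E]

lemma integrable_ballWeight_mul {f : E → ℝ} (hf : Continuous f) :
    Integrable (fun y => ballWeight y * f y) :=
  (continuous_ballWeight.mul hf).integrable_of_hasCompactSupport
    hasCompactSupport_ballWeight.mul_right

end BallWeight

/-! ### Harmonic functions and Green's identity. -/

section Harmonic

open InnerProductSpace Laplacian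
open scoped RealInnerProductSpace

variable {E F : Type*} [NormedAddCommGroup E] [InnerProductSpace ℝ E] [FiniteDimensional ℝ E]
  [NormedAddCommGroup F] [InnerProductSpace ℝ F]

lemma InnerProductSpace.HarmonicOnNhd.contDiff {u : E → F} (hu : HarmonicOnNhd u Set.univ) :
    ContDiff ℝ 2 u :=
  contDiff_iff_contDiffAt.2 fun y => (hu y trivial).1

lemma InnerProductSpace.HarmonicOnNhd.sum_fderiv_fderiv {u : E → F}
    (hu : HarmonicOnNhd u Set.univ) {ι : Type*} [Fintype ι] (b : OrthonormalBasis ι ℝ E) (y : E) :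
    ∑ i, fderiv ℝ (fderiv ℝ u) y (b i) (b i) = 0 := by
  have h := (hu y trivial).2.self_of_nhds
  rw [laplacian_eq_iteratedFDeriv_orthonormalBasis u b] at h
  simpa [iteratedFDeriv_two_apply] using h

lemma InnerProductSpace.HarmonicOnNhd.comp_affine {u : E → F} (hu : HarmonicOnNhd u Set.univ)
    (x : E) (c : ℝ) : HarmonicOnNhd (fun y => u (x + c • y)) Set.univ := by
  have h2 := hu.contDiff
  have hd : ∀ y, fderiv ℝ (fun y => u (x + c • y)) y = c • fderiv ℝ u (x + c • y) := fun y => by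
    rw [fderiv_comp_smul (f := fun z => u (x + z)), fderiv_comp_add_left]
  have hdd : ∀ y, fderiv ℝ (fderiv ℝ fun y => u (x + c • y)) y
      = c • c • fderiv ℝ (fderiv ℝ u) (x + c • y) := fun y => by
    have h1 : Differentiable ℝ (fderiv ℝ u) :=
      (h2.fderiv_right (m := 1) le_rfl).differentiable one_ne_zero
    have h : DifferentiableAt ℝ (fun y => fderiv ℝ u (x + c • y)) y := by fun_prop
    have h' : fderiv ℝ (fun y => c • fderiv ℝ u (x + c • y)) y
        = c • fderiv ℝ (fun y => fderiv ℝ u (x + c • y)) y := (h.hasFDerivAt.const_smul c).fderiv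
    rw [funext hd, h',
      fderiv_comp_smul (f := fun z => fderiv ℝ u (x + z)), fderiv_comp_add_left]
  refine fun y _ => ⟨by fun_prop, Filter.Eventually.of_forall fun z => ?_⟩
  rw [laplacian_eq_iteratedFDeriv_stdOrthonormalBasis]
  simp only [iteratedFDeriv_two_apply, hdd]
  have := hu.sum_fderiv_fderiv (stdOrthonormalBasis ℝ E) (x + c • z)
  simp [← Finset.smul_sum, this]

variable [MeasurableSpace E] [BorelSpace E]

/-- Green's second identity against the radial weight: the radial flux of two harmonic functions
through the spheres is symmetric. -/
lemma integral_ballWeight_radial_flux {U V : E → F} (hU : HarmonicOnNhd U Set.univ)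
    (hV : HarmonicOnNhd V Set.univ) :
    ∫ y, ballWeight y * (⟪fderiv ℝ U y y, V y⟫ - ⟪U y, fderiv ℝ V y y⟫) = 0 := by
  set b := stdOrthonormalBasis ℝ E
  have hU2 := hU.contDiff
  have hV2 := hV.contDiff
  have hU1 : ContDiff ℝ 1 (fderiv ℝ U) := hU2.fderiv_right le_rfl
  have hV1 : ContDiff ℝ 1 (fderiv ℝ V) := hV2.fderiv_right le_rfl
  have hUd : Differentiable ℝ U := hU2.differentiable two_ne_zero
  have hVd : Differentiable ℝ V := hV2.differentiable two_ne_zero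
  have hUd1 : Differentiable ℝ (fderiv ℝ U) := hU1.differentiable one_ne_zero
  have hVd1 : Differentiable ℝ (fderiv ℝ V) := hV1.differentiable one_ne_zero
  have hUc2 : Continuous (fderiv ℝ (fderiv ℝ U)) := hU1.continuous_fderiv one_ne_zero
  have hVc2 : Continuous (fderiv ℝ (fderiv ℝ V)) := hV1.continuous_fderiv one_ne_zero
  have hUc := hUd.continuous
  have hVc := hVd.continuous
  have hUc1 := hU1.continuous
  have hVc1 := hV1.continuous
  let W : E → ℝ := fun y => ballWeight y ^ 2 / 4
  have hWc : Continuous W := (continuous_ballWeight.pow 2).div_const 4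
  have hWs : HasCompactSupport W :=
    hasCompactSupport_ballWeight.comp_left (g := fun s : ℝ => s ^ 2 / 4) (by simp)
  have hWd : ∀ y v, fderiv ℝ W y v = -(ballWeight y * ⟪y, v⟫) := fun y v => by
    rw [(hasFDerivAt_ballWeight_sq y).fderiv]; simp
  let g : _ → E → ℝ := fun i y => ⟪fderiv ℝ U y (b i), V y⟫ - ⟪U y, fderiv ℝ V y (b i)⟫
  have hgc : ∀ i, Continuous (g i) := fun i => by fun_prop
  have hgd : ∀ i, Differentiable ℝ (g i) := fun i =>
    ((hUd1.clm_apply (differentiable_const (b i))).inner ℝ hVd).sub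
      (hUd.inner ℝ (hVd1.clm_apply (differentiable_const (b i))))
  -- The products of first derivatives cancel; summing over `i` leaves only Laplacians.
  have hg' : ∀ i y, fderiv ℝ (g i) y (b i) = ⟪fderiv ℝ (fderiv ℝ U) y (b i) (b i), V y⟫
      - ⟪U y, fderiv ℝ (fderiv ℝ V) y (b i) (b i)⟫ := fun i y => by
    have e1 : HasFDerivAt (fun z => fderiv ℝ U z (b i)) _ y :=
      (hUd1 y).hasFDerivAt.clm_apply (hasFDerivAt_const (b i) y)
    have e2 : HasFDerivAt (fun z => fderiv ℝ V z (b i)) _ y :=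
      (hVd1 y).hasFDerivAt.clm_apply (hasFDerivAt_const (b i) y)
    have e := (e1.inner ℝ (hVd y).hasFDerivAt).sub ((hUd y).hasFDerivAt.inner ℝ e2)
    have : fderiv ℝ (g i) y = _ := e.fderiv
    rw [this]
    simp
    ring
  have hg'c : ∀ i, Continuous fun y => fderiv ℝ (g i) y (b i) := fun i => by
    simp only [hg']; fun_prop
  have ibp : ∀ i, ∫ y, ballWeight y * (⟪y, b i⟫ * g i y) = ∫ y, W y * fderiv ℝ (g i) y (b i) := by
    intro i
    rw [integral_mul_fderiv_eq_neg_fderiv_mul_of_integrable, ← integral_neg]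
    · simp only [hWd]
      congr 1; ext y; ring
    · simp only [hWd]
      have := (integrable_ballWeight_mul (f := fun y => ⟪y, b i⟫ * g i y) (by fun_prop)).neg
      refine this.congr (Filter.Eventually.of_forall fun y => ?_)
      simp; ring
    · exact (hWc.mul (hg'c i)).integrable_of_hasCompactSupport hWs.mul_right
    · exact (hWc.mul (hgc i)).integrable_of_hasCompactSupport hWs.mul_right
    · exact fun y _ => (hasFDerivAt_ballWeight_sq y).differentiableAt
    · exact fun y _ => hgd i y
  have hexp : ∀ y, ballWeight y * (⟪fderiv ℝ U y y, V y⟫ - ⟪U y, fderiv ℝ V y y⟫)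
      = ∑ i, ballWeight y * (⟪y, b i⟫ * g i y) := fun y => by
    have h (L : E →L[ℝ] F) : L y = ∑ i, ⟪y, b i⟫ • L (b i) := by
      conv_lhs => rw [← b.sum_repr' y]
      simp [real_inner_comm]
    rw [h (fderiv ℝ U y), h (fderiv ℝ V y), sum_inner, inner_sum, ← Finset.sum_sub_distrib,
      Finset.mul_sum]
    refine Finset.sum_congr rfl fun i _ => ?_
    simp only [g, real_inner_smul_left, real_inner_smul_right]
    ring
  simp only [hexp]
  rw [integral_finsetSum _ fun i _ => integrable_ballWeight_mul (by fun_prop)]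
  simp only [ibp]
  rw [← integral_finsetSum (f := fun i y => W y * fderiv ℝ (g i) y (b i)) _ fun i _ =>
    (hWc.mul (hg'c i)).integrable_of_hasCompactSupport hWs.mul_right]
  refine integral_eq_zero_of_ae (Filter.Eventually.of_forall fun y => ?_)
  simp only [hg', ← Finset.mul_sum, Finset.sum_sub_distrib, ← sum_inner, ← inner_sum]
  rw [hU.sum_fderiv_fderiv b, hV.sum_fderiv_fderiv b]
  simp

end Harmonic

/-! ### Weighted energy, logarithmic convexity and three balls. -/

section Energy

open InnerProductSpace
open scoped RealInnerProductSpace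

variable {E F : Type*} [NormedAddCommGroup E] [InnerProductSpace ℝ E] [FiniteDimensional ℝ E]
  [MeasurableSpace E] [BorelSpace E] [NormedAddCommGroup F]

/-- The weighted mean square of `u` over the ball with centre `x` and radius `ρ`. -/
noncomputable def ballEnergy (u : E → F) (x : E) (ρ : ℝ) : ℝ :=
  ∫ y, ballWeight y * ‖u (x + ρ • y)‖ ^ 2

lemma ballEnergy_nonneg (u : E → F) (x : E) (ρ : ℝ) : 0 ≤ ballEnergy u x ρ :=
  integral_nonneg fun y => mul_nonneg (ballWeight_nonneg y) (sq_nonneg _)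

lemma setIntegral_ball_comp_affine (f : E → ℝ) (x : E) {ρ : ℝ} (hρ : 0 < ρ) (κ : ℝ) :
    ∫ y in Metric.ball (0 : E) κ, f (x + ρ • y)
      = (ρ ^ Module.finrank ℝ E)⁻¹ * ∫ z in Metric.ball x (ρ * κ), f z := by
  rw [Measure.setIntegral_comp_smul_of_pos volume (fun z => f (x + z)) _ hρ, smul_eq_mul,
    smul_ball hρ.ne', smul_zero, Real.norm_of_nonneg hρ.le,
    ← (measurePreserving_add_left volume x).setIntegral_preimage_emb
      (measurableEmbedding_addLeft x) f]
  congr 3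
  simp

lemma ballEnergy_le {u : E → F} (hu : Continuous u) (x : E) {ρ : ℝ} (hρ : 0 < ρ) :
    ballEnergy u x ρ
      ≤ (ρ ^ Module.finrank ℝ E)⁻¹ * ∫ z in Metric.ball x ρ, ‖u z‖ ^ 2 := by
  have h := setIntegral_ball_comp_affine (fun z => ‖u z‖ ^ 2) x hρ 1
  rw [mul_one] at h
  rw [← h, ballEnergy,
    ← setIntegral_eq_integral_of_forall_compl_eq_zero (s := Metric.ball (0 : E) 1) fun y hy => by
      rw [ballWeight_eq_zero (by simpa using hy), zero_mul]]
  have hi : IntegrableOn (fun y => ‖u (x + ρ • y)‖ ^ 2) (Metric.ball (0 : E) 1) :=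
    (Continuous.continuousOn (by fun_prop)).integrableOn_compact (isCompact_closedBall (0 : E) 1)
      |>.mono_set Metric.ball_subset_closedBall
  refine integral_mono (integrable_ballWeight_mul (by fun_prop)).integrableOn hi fun y => ?_
  exact mul_le_of_le_one_left (sq_nonneg _) (ballWeight_le_one y)

/-- The weight is at least 1 - κ² where ‖y‖ < κ; with `ballEnergy_le` this passes between energies
and plain means. -/
lemma le_ballEnergy {u : E → F} (hu : Continuous u) (x : E) {ρ κ : ℝ} (hρ : 0 < ρ) :
    (1 - κ ^ 2) * ((ρ ^ Module.finrank ℝ E)⁻¹ * ∫ z in Metric.ball x (ρ * κ), ‖u z‖ ^ 2)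
      ≤ ballEnergy u x ρ := by
  rw [← setIntegral_ball_comp_affine (fun z => ‖u z‖ ^ 2) x hρ κ, ← integral_const_mul]
  have hi : Integrable fun y => ballWeight y * ‖u (x + ρ • y)‖ ^ 2 :=
    integrable_ballWeight_mul (by fun_prop)
  refine le_trans ?_ (setIntegral_le_integral (s := Metric.ball (0 : E) κ) hi
    (Filter.Eventually.of_forall fun y => mul_nonneg (ballWeight_nonneg y) (sq_nonneg _)))
  have hi' : IntegrableOn (fun y => (1 - κ ^ 2) * ‖u (x + ρ • y)‖ ^ 2) (Metric.ball (0 : E) κ) :=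
    (Continuous.continuousOn (by fun_prop)).integrableOn_compact (isCompact_closedBall (0 : E) κ)
      |>.mono_set Metric.ball_subset_closedBall
  refine setIntegral_mono_on hi' hi.integrableOn measurableSet_ball fun y hy => ?_
  refine mul_le_mul_of_nonneg_right (le_max_of_le_right ?_) (sq_nonneg _)
  have : ‖y‖ < κ := by simpa using hy
  nlinarith [norm_nonneg y]

lemma setIntegral_ball_mono {u : E → F} (hu : Continuous u) {x y : E} {r R : ℝ}
    (h : Metric.ball x r ⊆ Metric.ball y R) :
    ∫ z in Metric.ball x r, ‖u z‖ ^ 2 ≤ ∫ z in Metric.ball y R, ‖u z‖ ^ 2 :=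
  setIntegral_mono_set
    ((Continuous.continuousOn (by fun_prop)).integrableOn_compact (isCompact_closedBall y R)
      |>.mono_set Metric.ball_subset_closedBall)
    (Filter.Eventually.of_forall fun _ => sq_nonneg _) h.eventuallyLE

variable [InnerProductSpace ℝ F]

/-- The pairing of the dilates of a harmonic function by `exp t` and `exp (-t)` does not depend
on `t`. -/
lemma InnerProductSpace.HarmonicOnNhd.integral_inner_exp_smul {u : E → F}
    (hu : HarmonicOnNhd u Set.univ) (t : ℝ) :
    ∫ y, ballWeight y * ⟪u (Real.exp t • y), u (Real.exp (-t) • y)⟫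
      = ∫ y, ballWeight y * ⟪u y, u y⟫ := by
  have hu2 := hu.contDiff
  have huc : Continuous u := hu2.continuous
  have hud : Differentiable ℝ u := hu2.differentiable two_ne_zero
  have huc1 : Continuous (fderiv ℝ u) := hu2.continuous_fderiv two_ne_zero
  let p : ℝ → E → ℝ := fun t y => ⟪u (Real.exp t • y), u (Real.exp (-t) • y)⟫
  let p' : ℝ → E → ℝ := fun t y =>
    ⟪fderiv ℝ u (Real.exp t • y) (Real.exp t • y), u (Real.exp (-t) • y)⟫
      - ⟪u (Real.exp t • y), fderiv ℝ u (Real.exp (-t) • y) (Real.exp (-t) • y)⟫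
  have hp'c : Continuous fun z : ℝ × E => p' z.1 z.2 := by fun_prop
  have hpc : ∀ t, Continuous (p t) := fun t => by fun_prop
  have hpd : ∀ t y, HasDerivAt (fun t => p t y) (p' t y) t := fun t y => by
    have e1 : HasDerivAt (fun t : ℝ => Real.exp t • y) (Real.exp t • y) t :=
      (Real.hasDerivAt_exp t).smul_const y
    have e2 : HasDerivAt (fun t : ℝ => Real.exp (-t) • y) (-(Real.exp (-t) • y)) t := by
      simpa using ((hasDerivAt_neg t).exp).smul_const y
    have f1 := (hud (Real.exp t • y)).hasFDerivAt.comp_hasDerivAt t e1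
    have f2 := (hud (Real.exp (-t) • y)).hasFDerivAt.comp_hasDerivAt t e2
    refine (f1.inner ℝ f2).congr_deriv ?_
    simp only [p', Function.comp, map_neg, inner_neg_right]
    ring
  -- The t-derivative of the pairing is the radial flux of two dilates, both harmonic.
  have hzero : ∀ t, ∫ y, ballWeight y * p' t y = 0 := fun t => by
    have hd : ∀ (c : ℝ) y, fderiv ℝ (fun y => u (c • y)) y y = fderiv ℝ u (c • y) (c • y) :=
      fun c y => by rw [fderiv_comp_smul]; simp
    have h (c : ℝ) : HarmonicOnNhd (fun y => u (c • y)) Set.univ := by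
      simpa using hu.comp_affine 0 c
    have := integral_ballWeight_radial_flux (h (Real.exp t)) (h (Real.exp (-t)))
    simpa only [hd] using this
  have hderiv : ∀ t, HasDerivAt (fun t => ∫ y, ballWeight y * p t y) 0 t := fun t => by
    obtain ⟨C, hC⟩ := ((isCompact_closedBall t 1).prod
      (isCompact_closedBall (0 : E) 1)).exists_bound_of_continuousOn hp'c.continuousOn
    have hp't : Continuous (p' t) := by fun_prop
    rw [← hzero t]
    refine (hasDerivAt_integral_of_dominated_loc_of_deriv_le
      (bound := fun y => ballWeight y * C) (F' := fun t y => ballWeight y * p' t y)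
      (Metric.closedBall_mem_nhds t one_pos)
      (Filter.Eventually.of_forall fun s =>
        (integrable_ballWeight_mul (hpc s)).aestronglyMeasurable)
      (integrable_ballWeight_mul (hpc t))
      (integrable_ballWeight_mul hp't).aestronglyMeasurable
      (Filter.Eventually.of_forall fun y s hs => ?_)
      (integrable_ballWeight_mul continuous_const)
      (Filter.Eventually.of_forall fun y s _ => (hpd s y).const_mul _)).2
    rcases le_total 1 ‖y‖ with hy | hy
    · simp [ballWeight_eq_zero hy]
    · rw [norm_mul, Real.norm_of_nonneg (ballWeight_nonneg y)]
      exact mul_le_mul_of_nonneg_left (hC (s, y) ⟨hs, by simpa using hy⟩) (ballWeight_nonneg y)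
  have := is_const_of_deriv_eq_zero (fun t => (hderiv t).differentiableAt)
    (fun t => (hderiv t).deriv) t 0
  simpa [p] using this

lemma integral_ballWeight_inner_sq_le {f g : E → F} (hf : Continuous f) (hg : Continuous g) :
    (∫ y, ballWeight y * ⟪f y, g y⟫) ^ 2
      ≤ (∫ y, ballWeight y * ‖f y‖ ^ 2) * ∫ y, ballWeight y * ‖g y‖ ^ 2 := by
  -- Cauchy–Schwarz from the discriminant of s ↦ ∫ w ‖f + s g‖².
  have h (s : ℝ) : 0 ≤ (∫ y, ballWeight y * ‖g y‖ ^ 2) * (s * s)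
      + (2 * ∫ y, ballWeight y * ⟪f y, g y⟫) * s + ∫ y, ballWeight y * ‖f y‖ ^ 2 := by
    have i1 := integrable_ballWeight_mul (f := fun y => ‖f y‖ ^ 2) (by fun_prop)
    have i2 := integrable_ballWeight_mul (f := fun y => ⟪f y, g y⟫) (by fun_prop)
    have i3 := integrable_ballWeight_mul (f := fun y => ‖g y‖ ^ 2) (by fun_prop)
    have : ∫ y, ballWeight y * ‖f y + s • g y‖ ^ 2
        = (∫ y, ballWeight y * ‖g y‖ ^ 2) * (s * s)
          + (2 * ∫ y, ballWeight y * ⟪f y, g y⟫) * s + ∫ y, ballWeight y * ‖f y‖ ^ 2 := by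
      rw [← integral_mul_const, ← integral_const_mul, ← integral_mul_const,
        ← integral_add (i3.mul_const _) ((i2.const_mul _).mul_const _),
        ← integral_add (f := fun y => ballWeight y * ‖g y‖ ^ 2 * (s * s)
          + 2 * (ballWeight y * ⟪f y, g y⟫) * s)
          ((i3.mul_const _).add ((i2.const_mul _).mul_const _)) i1]
      refine integral_congr_ae (Filter.Eventually.of_forall fun y => ?_)
      simp only [norm_add_sq_real, real_inner_smul_right, norm_smul, mul_pow, Real.norm_eq_abs,
        sq_abs]
      ring
    rw [← this]
    exact integral_nonneg fun y => mul_nonneg (ballWeight_nonneg y) (sq_nonneg _)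
  have := discrim_le_zero h
  rw [discrim] at this
  nlinarith

/-- Midpoint logarithmic convexity of the energy in `log ρ`. -/
lemma InnerProductSpace.HarmonicOnNhd.ballEnergy_sq_le {u : E → F}
    (hu : HarmonicOnNhd u Set.univ) (x : E) (ρ : ℝ) {q : ℝ} (hq : 0 < q) :
    ballEnergy u x ρ ^ 2 ≤ ballEnergy u x (q⁻¹ * ρ) * ballEnergy u x (q * ρ) := by
  have hv := hu.comp_affine x ρ
  have huc : Continuous u := hu.contDiff.continuous
  have h := hv.integral_inner_exp_smul (Real.log q)
  rw [Real.exp_neg, Real.exp_log hq] at h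
  simp only [real_inner_self_eq_norm_sq] at h
  rw [ballEnergy, ← h]
  refine (integral_ballWeight_inner_sq_le (by fun_prop) (by fun_prop)).trans_eq ?_
  simp only [ballEnergy, smul_smul, mul_comm ρ]
  ring

/-- Raise the midpoint inequality to the power k + 1, insert the induction hypothesis and cancel a
(k + 1) ^ k; a zero term is treated separately. -/
lemma pow_succ_le_of_sq_le {a : ℕ → ℝ} (ha : ∀ j, 0 ≤ a j)
    (h : ∀ j, a (j + 1) ^ 2 ≤ a j * a (j + 2)) (k : ℕ) :
    a k ^ (k + 1) ≤ a 0 * a (k + 1) ^ k := by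
  induction k with
  | zero => simp
  | succ k ih =>
    rcases (ha (k + 1)).eq_or_lt with h0 | h0
    · rw [← h0, zero_pow (by omega)]
      exact mul_nonneg (ha 0) (pow_nonneg (ha _) _)
    · have h1 : (a (k + 1) ^ 2) ^ (k + 1) ≤ (a k * a (k + 2)) ^ (k + 1) :=
        pow_le_pow_left₀ (sq_nonneg _) (h k) _
      rw [mul_pow] at h1
      have h2 := mul_le_mul_of_nonneg_right ih (pow_nonneg (ha (k + 2)) (k + 1))
      refine le_of_mul_le_mul_left ?_ (pow_pos h0 k)
      calc a (k + 1) ^ k * a (k + 1) ^ (k + 1 + 1) = (a (k + 1) ^ 2) ^ (k + 1) := by ring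
        _ ≤ a 0 * a (k + 1) ^ k * a (k + 2) ^ (k + 1) := h1.trans h2
        _ = _ := by ring

/-- Hadamard's three balls inequality along a geometric sequence of radii. -/
lemma InnerProductSpace.HarmonicOnNhd.ballEnergy_pow_le {u : E → F}
    (hu : HarmonicOnNhd u Set.univ) (x : E) (ρ : ℝ) {q : ℝ} (hq : 0 < q) (k : ℕ) :
    ballEnergy u x (ρ * q ^ k) ^ (k + 1)
      ≤ ballEnergy u x ρ * ballEnergy u x (ρ * q ^ (k + 1)) ^ k := by
  have := pow_succ_le_of_sq_le (a := fun j => ballEnergy u x (ρ * q ^ j))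
    (fun j => ballEnergy_nonneg _ _ _) (fun j => ?_) k
  · simpa using this
  · refine (hu.ballEnergy_sq_le x _ hq).trans_eq ?_
    congr 2
    · field_simp
      ring
    · ring

/-- A convex function of log ρ that stays bounded as ρ → 0 cannot decrease. If E(R) < E(r), the
chain started at r/qᵏ with q = R/r gives E(r) ≤ M (E(R)/E(r))ᵏ → 0. -/
lemma InnerProductSpace.HarmonicOnNhd.ballEnergy_mono {u : E → F}
    (hu : HarmonicOnNhd u Set.univ) (x : E) {r R : ℝ} (hr : 0 < r) (hrR : r ≤ R) :
    ballEnergy u x r ≤ ballEnergy u x R := by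
  have huc : Continuous u := hu.contDiff.continuous
  by_contra! hlt
  have hX : 0 < ballEnergy u x r := (ballEnergy_nonneg u x R).trans_lt hlt
  have hR : 0 < R := hr.trans_le hrR
  obtain ⟨C, hC⟩ := (isCompact_closedBall x r).exists_bound_of_continuousOn huc.continuousOn
  have hM : ∀ ρ, 0 ≤ ρ → ρ ≤ r → ballEnergy u x ρ ≤ ∫ y : E, ballWeight y * C ^ 2 := by
    intro ρ h0 hρ
    refine integral_mono (integrable_ballWeight_mul (f := fun y => ‖u (x + ρ • y)‖ ^ 2)
      (by fun_prop)) (integrable_ballWeight_mul continuous_const) fun y => ?_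
    rcases le_total 1 ‖y‖ with hy | hy
    · simp [ballWeight_eq_zero hy]
    · refine mul_le_mul_of_nonneg_left (pow_le_pow_left₀ (norm_nonneg _) (hC _ ?_) 2)
        (ballWeight_nonneg y)
      rw [Metric.mem_closedBall, dist_eq_norm, add_sub_cancel_left, norm_smul,
        Real.norm_of_nonneg h0]
      nlinarith [norm_nonneg y]
  set M := ∫ y : E, ballWeight y * C ^ 2
  set q := R / r with hq
  have hq1 : 1 ≤ q := (one_le_div hr).2 hrR
  have hq0 : 0 < q := one_pos.trans_le hq1
  have hk : ∀ k : ℕ, ballEnergy u x r ≤ M * (ballEnergy u x R / ballEnergy u x r) ^ k := by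
    intro k
    have h := hu.ballEnergy_pow_le x (r / q ^ k) hq0 k
    have e1 : r / q ^ k * q ^ k = r := by field_simp
    have e2 : r / q ^ k * q ^ (k + 1) = R := by
      rw [pow_succ, ← mul_assoc, e1, hq]; field_simp
    rw [e1, e2] at h
    have h' := h.trans (mul_le_mul_of_nonneg_right
      (hM _ (by positivity) (div_le_self hr.le (one_le_pow₀ hq1)))
      (pow_nonneg (ballEnergy_nonneg u x R) k))
    rw [div_pow, ← mul_div_assoc, le_div_iff₀ (pow_pos hX k)]
    linarith [pow_succ' (ballEnergy u x r) k]
  have hlim := (tendsto_pow_atTop_nhds_zero_of_lt_one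
    (div_nonneg (ballEnergy_nonneg u x R) hX.le) ((div_lt_one hX).2 hlt)).const_mul M
  rw [mul_zero] at hlim
  exact hX.not_ge (ge_of_tendsto' hlim hk)

lemma InnerProductSpace.HarmonicOnNhd.eq_zero_of_ballEnergy_eq_zero {u : E → F}
    (hu : HarmonicOnNhd u Set.univ) {x : E} {ρ : ℝ} (hρ : 0 < ρ) (h : ballEnergy u x ρ = 0)
    (y : E) : u y = 0 := by
  have huc : Continuous u := hu.contDiff.continuous
  obtain ⟨k, hk⟩ := pow_unbounded_of_one_lt (‖y - x‖ / ρ) one_lt_two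
  rw [div_lt_iff₀' hρ] at hk
  have h0 : ballEnergy u x (ρ * 2 ^ k) = 0 := by
    have := hu.ballEnergy_pow_le x ρ two_pos k
    rw [h, zero_mul] at this
    exact pow_eq_zero_iff (by omega) |>.1 (this.antisymm (pow_nonneg (ballEnergy_nonneg _ _ _) _))
  set s := ρ * 2 ^ k
  have hs : 0 < s := by positivity
  by_contra hy
  have hw : 0 < ballWeight (s⁻¹ • (y - x)) := by
    have : ‖s⁻¹ • (y - x)‖ < 1 := by
      rw [norm_smul, norm_inv, Real.norm_of_nonneg hs.le, inv_mul_lt_one₀ hs]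
      exact hk
    refine lt_max_of_lt_right ?_
    nlinarith [norm_nonneg (s⁻¹ • (y - x))]
  have hpos : 0 < ballEnergy u x s := by
    refine Continuous.integral_pos_of_hasCompactSupport_nonneg_nonzero
      (x := s⁻¹ • (y - x)) (continuous_ballWeight.mul (by fun_prop))
      hasCompactSupport_ballWeight.mul_right
      (fun z => mul_nonneg (ballWeight_nonneg z) (sq_nonneg _)) ?_
    have : x + s • s⁻¹ • (y - x) = y := by
      rw [smul_inv_smul₀ hs.ne', add_sub_cancel]
    simp only [this]
    have := norm_pos_iff.2 hy
    positivity
  exact hpos.ne' h0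

end Energy

/-! ### Propagation of smallness and the conclusion. -/

section Main

open InnerProductSpace

variable {n : ℕ} {u : EuclideanSpace ℝ (Fin n) → ℂ}

lemma ballMean_nonneg (p : ℝ) (x : EuclideanSpace ℝ (Fin n)) (r : ℝ) : 0 ≤ ballMean p x r u :=
  Real.rpow_nonneg (mul_nonneg (inv_nonneg.2 measureReal_nonneg)
    (integral_nonneg fun _ => Real.rpow_nonneg (norm_nonneg _) _)) _

lemma setIntegral_ball_eq_ballMean (x : EuclideanSpace ℝ (Fin n)) {r : ℝ} (hr : 0 < r) :
    ∫ z in Metric.ball x r, ‖u z‖ ^ 2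
      = r ^ n * volume.real (Metric.ball (0 : EuclideanSpace ℝ (Fin n)) 1)
        * ballMean 2 x r u ^ 2 := by
  have hv : volume.real (Metric.ball x r)
      = r ^ n * volume.real (Metric.ball (0 : EuclideanSpace ℝ (Fin n)) 1) := by
    rw [Measure.real, Measure.addHaar_ball_of_pos volume x hr, ENNReal.toReal_mul,
      ENNReal.toReal_ofReal (by positivity), finrank_euclideanSpace_fin, Measure.real]
  have hpos : 0 < volume.real (Metric.ball x r) :=
    ENNReal.toReal_pos (Metric.measure_ball_pos volume x hr).ne' measure_ball_lt_top.ne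
  rw [← hv, ballMean, ← Real.sqrt_eq_rpow, Real.sq_sqrt]
  · simp only [Real.rpow_two]
    rw [mul_inv_cancel_left₀ hpos.ne']
  · exact mul_nonneg (inv_nonneg.2 measureReal_nonneg)
      (integral_nonneg fun _ => Real.rpow_nonneg (norm_nonneg _) _)

/-- Propagation of smallness from `B_{x,r}` to a ball centred at the origin. -/
lemma InnerProductSpace.HarmonicOnNhd.ballEnergy_zero_le (hu : HarmonicOnNhd u Set.univ)
    {x : EuclideanSpace ℝ (Fin n)} {r ε b B : ℝ} (hr : 0 < 2 * r) (hrx : 2 * r ≤ ‖x‖)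
    (hB : 1 ≤ B)
    (hB' : 2 ^ n * volume.real (Metric.ball (0 : EuclideanSpace ℝ (Fin n)) 1) ≤ B)
    (hε : 0 < ε) (hε1 : Real.log ε ≤ 0) (hAε : ballMean 2 x r u ≤ ε)
    (hb : ballMean 2 0 (4 * ‖x‖) u ≤ b) :
    ballEnergy u 0 (‖x‖ / 2) ≤ 3 * 5 ^ n * (B *
      Real.exp (2 * (1 / Real.log (2 * ‖x‖ / r) / 100 * Real.log ε + b))) := by
  have huc : Continuous u := hu.contDiff.continuous
  have hr0 : 0 < r := by linarith
  set R := ‖x‖ with hRdef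
  have hR : 0 < R := hr.trans_le hrx
  set V := volume.real (Metric.ball (0 : EuclideanSpace ℝ (Fin n)) 1) with hV
  have hV0 : 0 ≤ V := measureReal_nonneg
  have hVB : V ≤ B := (le_mul_of_one_le_left hV0 (one_le_pow₀ one_le_two)).trans hB'
  -- The outer radius 5ρ/4 is at most 3R, so its ball about x lies in B(0, 4R). It exceeds 12R/5, so
  -- 4ρ/5 > 3R/2 and B(x, 4ρ/5) contains B(0, R/2).
  obtain ⟨j, hj1, hj2⟩ := exists_nat_pow_near (x := 3 * R / r) (y := (5 / 4 : ℝ))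
    (by rw [one_le_div hr0]; linarith) (by norm_num)
  obtain ⟨k, rfl⟩ : ∃ k, j = k + 1 := Nat.exists_eq_succ_of_ne_zero fun h0 => by
    rw [h0, zero_add, pow_one, div_lt_iff₀ hr0] at hj2
    linarith
  rw [le_div_iff₀ hr0] at hj1
  rw [div_lt_iff₀ hr0] at hj2
  set ρ := r * (5 / 4 : ℝ) ^ k with hρ
  have hρ0 : 0 < ρ := by positivity
  have hρ' : r * (5 / 4 : ℝ) ^ (k + 1) = ρ * (5 / 4) := by rw [hρ, pow_succ]; ring
  have hρ1 : ρ * (5 / 4) ≤ 3 * R := by rw [← hρ']; linarith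
  have hρ2 : 3 * R < ρ * (5 / 4) * (5 / 4) := by
    rw [← hρ']; rw [pow_succ] at hj2; linarith
  have h0 : ballEnergy u x r ≤ B * Real.exp (2 * Real.log ε) := by
    refine (ballEnergy_le huc x hr0).trans ?_
    rw [setIntegral_ball_eq_ballMean x hr0, finrank_euclideanSpace_fin, two_mul, Real.exp_add,
      Real.exp_log hε, mul_assoc, inv_mul_cancel_left₀ (by positivity), ← sq]
    exact mul_le_mul hVB (pow_le_pow_left₀ (ballMean_nonneg _ _ _) hAε 2) (sq_nonneg _)
      (by linarith)
  have h1 : ballEnergy u x (ρ * (5 / 4)) ≤ B * Real.exp (2 * b) := by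
    have hb0 := (ballMean_nonneg _ _ _).trans hb
    have hsub : Metric.ball x (ρ * (5 / 4))
        ⊆ Metric.ball (0 : EuclideanSpace ℝ (Fin n)) (4 * R) :=
      Metric.ball_subset_ball' (by rw [dist_zero_right]; linarith)
    refine (ballEnergy_le huc x (by positivity)).trans
      ((mul_le_mul_of_nonneg_left (setIntegral_ball_mono huc hsub) (by positivity)).trans ?_)
    rw [setIntegral_ball_eq_ballMean 0 (by positivity), finrank_euclideanSpace_fin, ← mul_assoc,
      ← mul_assoc, ← inv_pow, ← mul_pow, two_mul, Real.exp_add, ← sq]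
    have hq : (ρ * (5 / 4))⁻¹ * (4 * R) ≤ 2 := by
      rw [inv_mul_le_iff₀ (by positivity)]; linarith
    refine mul_le_mul ((mul_le_mul_of_nonneg_right (pow_le_pow_left₀ (by positivity) hq n)
      hV0).trans hB') (pow_le_pow_left₀ (ballMean_nonneg _ _ _) ?_ 2) (sq_nonneg _) (by linarith)
    -- The crude b ≤ exp b puts the growth bound into the same exponent as log ε.
    exact hb.trans ((Real.add_one_le_exp b).trans' (by linarith))
  have h2 : ballEnergy u x ρ
      ≤ B * Real.exp (2 * (Real.log ε / (k + 1 : ℕ) + b)) := by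
    refine le_of_pow_le_pow_left₀ (n := k + 1) (by omega) (by positivity) ?_
    have h := hu.ballEnergy_pow_le x r (q := 5 / 4) (by norm_num) k
    rw [hρ'] at h
    have hb0 := (ballMean_nonneg _ _ _).trans hb
    have hk : ((k + 1 : ℕ) : ℝ) ≠ 0 := by positivity
    calc ballEnergy u x ρ ^ (k + 1)
        ≤ B * Real.exp (2 * Real.log ε) * (B * Real.exp (2 * b)) ^ k :=
          h.trans (mul_le_mul h0 (pow_le_pow_left₀ (ballEnergy_nonneg _ _ _) h1 k)
            (pow_nonneg (ballEnergy_nonneg _ _ _) k) (by positivity))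
      _ = B ^ (k + 1) * Real.exp (2 * Real.log ε + k * (2 * b)) := by
          rw [Real.exp_add, Real.exp_nat_mul]; ring
      _ ≤ B ^ (k + 1) * Real.exp ((k + 1 : ℕ) * (2 * (Real.log ε / (k + 1 : ℕ) + b))) := by
          gcongr
          have : ((k + 1 : ℕ) : ℝ) * (2 * (Real.log ε / (k + 1 : ℕ) + b))
              = 2 * Real.log ε + (k + 1 : ℕ) * (2 * b) := by field_simp
          rw [this]
          push_cast
          linarith
      _ = _ := by rw [Real.exp_nat_mul]; ring
  have h3 : Real.log ε / (k + 1 : ℕ) ≤ 1 / Real.log (2 * R / r) / 100 * Real.log ε := by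
    have h4 : 4 ≤ 2 * R / r := by rw [le_div_iff₀ hr0]; linarith
    have hL : 0 < Real.log (2 * R / r) := Real.log_pos (by linarith)
    have hq : 1 / 5 ≤ Real.log (5 / 4) := by
      have := Real.one_sub_inv_le_log_of_pos (x := 5 / 4) (by norm_num)
      norm_num at this ⊢
      exact this
    -- With s = 2R/r ≥ 4, (5/4)ᵏ⁺¹ ≤ 3s/2 ≤ s². As log(5/4) ≥ 1/5, k + 1 ≤ 10 log s, well within the
    -- constant 100.
    have hk : ((k + 1 : ℕ) : ℝ) * Real.log (5 / 4) ≤ 2 * Real.log (2 * R / r) := by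
      have e : (2 : ℝ) * Real.log (2 * R / r) = Real.log ((2 * R / r) ^ 2) := by
        rw [Real.log_pow]; norm_num
      rw [e, ← Real.log_pow]
      refine Real.log_le_log (by positivity) ?_
      refine ((le_div_iff₀ hr0).2 hj1).trans ?_
      have : 3 * R / r = 3 / 2 * (2 * R / r) := by ring
      rw [this, sq]
      exact mul_le_mul_of_nonneg_right (by linarith) (by linarith)
    have hk0 : (0 : ℝ) < (k + 1 : ℕ) := by positivity
    rw [div_eq_mul_one_div, mul_comm]
    refine mul_le_mul_of_nonpos_right ?_ hε1
    rw [div_div]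
    refine one_div_le_one_div_of_le hk0 ?_
    nlinarith
  -- The 3 comes from 1 - (4/5)² = 9/25 ≥ 1/3, the 5ⁿ from ρ ≤ 12R/5 ≤ 5R/2.
  have h4 : ballEnergy u 0 (R / 2) ≤ 3 * 5 ^ n * ballEnergy u x ρ := by
    have hsub : Metric.ball (0 : EuclideanSpace ℝ (Fin n)) (R / 2)
        ⊆ Metric.ball x (ρ * (4 / 5)) :=
      Metric.ball_subset_ball' (by rw [dist_zero_left]; linarith)
    have hI := setIntegral_ball_mono huc hsub
    have hlow := le_ballEnergy huc x (κ := 4 / 5) hρ0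
    have hup := ballEnergy_le huc 0 (ρ := R / 2) (by positivity)
    rw [finrank_euclideanSpace_fin] at hlow hup
    set I := ∫ z in Metric.ball x (ρ * (4 / 5)), ‖u z‖ ^ 2 with hIdef
    have hI0 : 0 ≤ I := integral_nonneg fun _ => sq_nonneg _
    have hq : ((R / 2) ^ n)⁻¹ ≤ 5 ^ n * (ρ ^ n)⁻¹ := by
      rw [← inv_pow, ← inv_pow, ← mul_pow]
      refine pow_le_pow_left₀ (by positivity) ?_ n
      rw [← div_eq_mul_inv, inv_le_comm₀ (by positivity) (by positivity), inv_div,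
        div_le_iff₀ (by norm_num)]
      linarith
    have hJ : (ρ ^ n)⁻¹ * I ≤ 3 * ballEnergy u x ρ := by
      have : 0 ≤ (ρ ^ n)⁻¹ * I := by positivity
      norm_num at hlow
      linarith
    calc ballEnergy u 0 (R / 2) ≤ ((R / 2) ^ n)⁻¹ * I :=
          hup.trans (mul_le_mul_of_nonneg_left hI (by positivity))
      _ ≤ 5 ^ n * (ρ ^ n)⁻¹ * I := mul_le_mul_of_nonneg_right hq hI0
      _ = 5 ^ n * ((ρ ^ n)⁻¹ * I) := by ring
      _ ≤ 5 ^ n * (3 * ballEnergy u x ρ) := mul_le_mul_of_nonneg_left hJ (by positivity)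
      _ = _ := by ring
  refine h4.trans (mul_le_mul_of_nonneg_left (h2.trans ?_) (by positivity))
  refine mul_le_mul_of_nonneg_left (Real.exp_le_exp.2 ?_) (by linarith)
  linarith

end Main

theorem theorem3 (n : ℕ) (hn : 2 ≤ n)
    (u : EuclideanSpace ℝ (Fin n) → ℂ)
    (hu : InnerProductSpace.HarmonicOnNhd u Set.univ)
    (φ : ℝ → ℝ) (hφ : MonotoneOn φ (Set.Ici 0))
    (hAφ : ∀ r : ℝ, 0 < r → ballMeanZero 2 r u ≤ φ r)
    (x : ℕ → EuclideanSpace ℝ (Fin n)) (r ε : ℕ → ℝ)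
    (hr : ∀ m, 0 < 2 * r m ∧ 2 * r m ≤ ‖x m‖)
    (hx : ¬ Filter.Tendsto x Filter.atTop (nhds 0))
    (hε : ∀ m, 0 < ε m)
    (hAε : ∀ m, ballMean 2 (x m) (r m) u ≤ ε m)
    (hlim : Filter.Tendsto
      (fun m => (1 / Real.log (2 * ‖x m‖ / r m)) / 100 * Real.log (ε m) + φ (4 * ‖x m‖))
      Filter.atTop Filter.atBot) :
    ∀ y, u y = 0 := by
  obtain ⟨δ, hδ, hfreq⟩ : ∃ δ > 0, ∃ᶠ m in Filter.atTop, δ ≤ ‖x m‖ := by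
    by_contra! h
    refine hx (Metric.tendsto_nhds.2 fun δ hδ => ?_)
    simpa [Filter.not_frequently] using h δ hδ
  set B := max 1 (2 ^ n * volume.real (Metric.ball (0 : EuclideanSpace ℝ (Fin n)) 1))
  refine hu.eq_zero_of_ballEnergy_eq_zero (x := 0) (ρ := δ / 2) (by positivity)
    (le_antisymm ?_ (ballEnergy_nonneg _ _ _))
  have hexp := ((Real.tendsto_exp_atBot.comp (hlim.const_mul_atBot two_pos)).const_mul
    B).const_mul (3 * 5 ^ n)
  simp only [mul_zero] at hexp
  refine le_of_forall_gt fun η hη => ?_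
  obtain ⟨m, hm, hmη, hm0⟩ := (hfreq.and_eventually
    ((hexp.eventually (gt_mem_nhds hη)).and (hlim.eventually (Filter.eventually_lt_atBot 0)))).exists
  obtain ⟨hr1, hr2⟩ := hr m
  have hR : 0 < ‖x m‖ := hr1.trans_le hr2
  have hb := hAφ (4 * ‖x m‖) (by positivity)
  -- φ(4|x_m|) ≥ 0 because it bounds a mean, so a negative bracket rules out log ε_m > 0.
  have hlog : Real.log (ε m) ≤ 0 := by
    by_contra! hpos
    have hL : 0 ≤ Real.log (2 * ‖x m‖ / r m) := by
      refine Real.log_nonneg ?_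
      rw [one_le_div (by linarith)]
      linarith
    have h1 : 0 ≤ 1 / Real.log (2 * ‖x m‖ / r m) / 100 * Real.log (ε m) := by positivity
    have h2 : 0 ≤ φ (4 * ‖x m‖) := (ballMean_nonneg _ _ _).trans hb
    linarith
  exact ((hu.ballEnergy_mono 0 (by positivity) (by linarith)).trans
    (hu.ballEnergy_zero_le hr1 hr2 (le_max_left _ _) (le_max_right _ _) (hε m) hlog (hAε m)
      hb)).trans_lt hmη
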